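/- For $\lambda>0$ let $G^\lambda$ denote a gamma random variable with density $\Gamma(\lambda)^{-1}y^{\lambda-1}e^{-y}$ on $(0,\infty)$. For $\alpha,\beta>0$ let $S^{\alpha,\beta}_m=\sum_{i=1}^m X^{\alpha,\beta}_i$ be the random walk with i.i.d. steps whose common distribution is that of $\log G^\alpha-\log G^\beta$ with $G^\alpha$ and $G^\beta$ independent, and let $\mu_{\alpha,\beta}=\mathbb{E}[X^{\alpha,\beta}_1]$. Fix $0<\rho_{\min}\le\rho_{\max}<\infty$ and $a_0>0$. Then there exist finite constants $C>0$ and $N_0\ge 1$, depending only on $(a_0,\rho_{\min},\rho_{\max})$, such that the following holds. Let $(s_N)$ be any sequence of real numbers with $0\le s_N\le a_0(\log N)^{-3}$ for all $N\ge 2$. Then for all integers $N\ge N_0$, all $\alpha,\beta\in[\rho_{\min},\rho_{\max}]$ with $-s_N\le\alpha-\beta\le 0$, and all real $x\ge(\log N)^2$, $$\mathbb{P}\Big\{\max_{1\le m\le N}S^{\alpha,\beta}_m\le x\Big\}\;\le\; C\,x\,(\log N)\,\big(|\mu_{\alpha,\beta}|\vee N^{-1/2}\big).$$ -/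

import Mathlib

open MeasureTheory ProbabilityTheory

noncomputable section

/-- The law of `log G^α - log G^β`, where `G^α` and `G^β` are independent gamma variables
with shape parameters `α`, `β` and rate `1`. -/
def logGammaStepLaw (α β : ℝ) : Measure ℝ :=
  ((gammaMeasure α 1).prod (gammaMeasure β 1)).map
    (fun g : ℝ × ℝ => Real.log g.1 - Real.log g.2)

/-- The mean step of the log-gamma walk. -/
def logGammaMean (α β : ℝ) : ℝ := ∫ y, y ∂(logGammaStepLaw α β)

/-- `X 0, X 1, X 2, …` are the i.i.d. steps of a log-gamma walk with parameters `α`, `β`. -/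
structure IsLogGammaSteps {Ω : Type*} [MeasurableSpace Ω] (P : Measure Ω) (α β : ℝ)
    (X : ℕ → Ω → ℝ) : Prop where
  indep : iIndepFun X P
  law : ∀ i, HasLaw (X i) (logGammaStepLaw α β) P

/-- The random walk `S_m`, the sum of the first `m` steps. -/
def walk {Ω : Type*} (X : ℕ → Ω → ℝ) (m : ℕ) (ω : Ω) : ℝ := ∑ i ∈ Finset.range m, X i ω

/-- The running maximum of `S_m` over `1 ≤ m ≤ N`. -/
def runningMax {Ω : Type*} (X : ℕ → Ω → ℝ) (N : ℕ) (ω : Ω) : ℝ :=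
  ⨆ m : Finset.Icc 1 N, walk X m ω

theorem runningMax_le_iff {Ω : Type*} (X : ℕ → Ω → ℝ) {N : ℕ} (hN : 1 ≤ N) (ω : Ω) (x : ℝ) :
    runningMax X N ω ≤ x ↔ ∀ m ∈ Finset.Icc 1 N, walk X m ω ≤ x := by
  have : Nonempty (Finset.Icc 1 N) := ⟨⟨1, by simp [hN]⟩⟩
  unfold runningMax
  rw [ciSup_le_iff (Set.finite_range _).bddAbove]
  exact ⟨fun h m hm => h ⟨m, hm⟩, fun h m => h m m.2⟩

/-- The admissible pairs: `α, β ∈ [ρmin, ρmax]` with `-s ≤ α - β ≤ 0`. -/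
def admissiblePairs (ρmin ρmax s : ℝ) : Set (ℝ × ℝ) :=
  {p | p.1 ∈ Set.Icc ρmin ρmax ∧ p.2 ∈ Set.Icc ρmin ρmax ∧ -s ≤ p.1 - p.2 ∧ p.1 - p.2 ≤ 0}

end

open MeasureTheory ProbabilityTheory

/-! The walk is compared with a supersolution. Write `w = 2x - y` for the distance of the walk from
`2x`. The concave parabola `2Lw - w²` loses the second moment of a step on average, up to a drift
term of size at most `2L|μ|`. With `L` a small multiple of the inverse of `|μ| ∨ N^{-1/2}`, the
drift is absorbed. After division by `L²/2` the loss per step is at least `1/N`, so adding the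
linear term `1 - n/N`, with `n` steps left, gives a function that dominates survival
(`measure_walk_le_of_supersolution`). Its value at the start is at most `8x/L`, of order `x (|μ| ∨
N^{-1/2})`; the factor `log N` is needed only to be at least `1`.

The parabola must be capped to stay between `0` and `L²`. A surviving walk has `w ≥ x`, so a step
reaches the lower cap only if it exceeds `x ≥ (log N)²`. Exponential moments, uniform in the
parameters, make this cost negligible against `L ≤ √N` (`eventually_parabolaError_le`). -/

/-! ### Survival probabilities and supersolutions. -/

/-- If `W n y` dominates the probability of staying below `x` one step at a time, then it bounds
the probability that the walk stays below `x`. -/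
theorem measure_walk_le_of_supersolution {Ω : Type*} [MeasurableSpace Ω] {P : Measure Ω}
    [IsProbabilityMeasure P] {X : ℕ → Ω → ℝ} {ν : Measure ℝ} [IsProbabilityMeasure ν]
    (hind : iIndepFun X P) (hlaw : ∀ i, HasLaw (X i) ν P) {x : ℝ} {W : ℕ → ℝ → ENNReal}
    (hWm : ∀ n, Measurable (W n)) (hW0 : ∀ y, 1 ≤ W 0 y)
    (hstep : ∀ n y, y ≤ x →
      ∫⁻ t, (Set.Iic x).indicator (W n) (y + t) ∂ν ≤ W (n + 1) y) (N : ℕ) :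
    P {ω | ∀ k ≤ N, walk X k ω ≤ x} ≤ W N 0 := by
  set w : ℕ → (ℕ → ℝ) → ℝ := fun k s => ∑ i ∈ Finset.range k, s i with hw
  have hwm : ∀ k, Measurable (w k) := fun k => by
    simp only [hw]; fun_prop
  set A : ℕ → Set (ℕ → ℝ) := fun m => {s | ∀ k ≤ m, w k s ≤ x} with hA
  have hAm : ∀ m, MeasurableSet (A m) := fun m => by
    have : A m = ⋂ k ∈ Finset.range (m + 1), (w k) ⁻¹' Set.Iic x := by
      ext s; simp [hA]
    rw [this]
    exact Finset.measurableSet_biInter _ fun k _ => hwm k measurableSet_Iic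
  -- Supermartingale property: `m` steps are done and `n` remain, and the mean of `W` on survival
  -- does not increase with `m`.
  have key : ∀ m n, n + m = N →
      ∫⁻ ω, (A m).indicator (fun s => W n (w m s)) (fun i => X i ω) ∂P ≤ W N 0 := by
    intro m
    induction m with
    | zero =>
      intro n hn
      obtain rfl : n = N := by simpa using hn
      calc _ ≤ ∫⁻ _ : Ω, W n 0 ∂P := by
            refine lintegral_mono fun ω => ?_
            refine (Set.indicator_le_self' (fun _ _ => zero_le) _).trans ?_
            simp [hw]
        _ = W n 0 := by simp
    | succ m ih =>
      intro n hn
      refine le_trans ?_ (ih (n + 1) (by omega))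
      -- Padding by zeros lets `w m` and `A m`, which see only the first `m` coordinates, be read
      -- off the past `Y`, which is independent of `X m`.
      set e : (Finset.range m → ℝ) → (ℕ → ℝ) :=
        fun y i => if h : i ∈ Finset.range m then y ⟨i, h⟩ else 0 with he
      have hem : Measurable e := by
        refine measurable_pi_lambda _ fun i => ?_
        by_cases h : i ∈ Finset.range m
        · simp only [he, h, dite_true]; exact measurable_pi_apply _
        · simp only [he, h, dite_false]; exact measurable_const
      have hwe : ∀ k ≤ m, ∀ s : ℕ → ℝ, w k (e fun i => s i) = w k s := by
        intro k hk s
        refine Finset.sum_congr rfl fun i hi => ?_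
        have : i < m := (Finset.mem_range.1 hi).trans_le hk
        simp [he, this]
      have hAe : ∀ s : ℕ → ℝ, (e fun i => s i) ∈ A m ↔ s ∈ A m := fun s =>
        forall₂_congr fun k hk => by rw [hwe k hk]
      set Y : Ω → (Finset.range m → ℝ) := fun ω i => X i ω with hY
      have hwY : ∀ ω, w m (e (Y ω)) = w m (fun i => X i ω) :=
        fun ω => hwe m le_rfl fun i => X i ω
      have hAY : ∀ ω, e (Y ω) ∈ A m ↔ (fun i => X i ω) ∈ A m := fun ω => hAe fun i => X i ω
      have hXm : ∀ i, AEMeasurable (X i) P := fun i => (hlaw i).aemeasurable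
      have hYm : AEMeasurable Y P := aemeasurable_pi_lambda _ fun i => hXm i
      have hYX : IndepFun Y (X m) P := by
        have h := hind.indepFun_finset₀ (Finset.range m) {m} (by simp) hXm
        have hev : Measurable fun z : ({m} : Finset ℕ) → ℝ => z ⟨m, by simp⟩ :=
          measurable_pi_apply _
        exact h.comp measurable_id hev
      have hjoint := (indepFun_iff_map_prod_eq_prod_map_map hYm (hXm m)).1 hYX
      rw [(hlaw m).map_eq] at hjoint
      set F : (Finset.range m → ℝ) × ℝ → ENNReal := fun p =>
        (A m).indicator 1 (e p.1) * (Set.Iic x).indicator (W n) (w m (e p.1) + p.2) with hF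
      have hFm : Measurable F := by
        have h1 : Measurable ((A m).indicator (1 : (ℕ → ℝ) → ENNReal)) :=
          measurable_one.indicator (hAm m)
        have h2 : Measurable ((Set.Iic x).indicator (W n)) :=
          (hWm n).indicator measurableSet_Iic
        have h3 := hwm m
        simp only [hF]
        fun_prop
      calc ∫⁻ ω, (A (m + 1)).indicator (fun s => W n (w (m + 1) s)) (fun i => X i ω) ∂P
          = ∫⁻ ω, F (Y ω, X m ω) ∂P := by
            refine lintegral_congr fun ω => ?_
            have hsucc : w (m + 1) (fun i => X i ω) = w m (fun i => X i ω) + X m ω := by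
              simp [hw, Finset.sum_range_succ]
            have hmem : (fun i => X i ω) ∈ A (m + 1) ↔
                (fun i => X i ω) ∈ A m ∧ w m (fun i => X i ω) + X m ω ≤ x := by
              rw [← hsucc]
              constructor
              · exact fun h => ⟨fun k hk => h k (by omega), h _ le_rfl⟩
              · rintro ⟨h1, h2⟩ k hk
                rcases Nat.le_succ_iff.1 hk with h | h
                · exact h1 k h
                · rw [h]; exact h2
            simp only [hF, hwY, Set.indicator_apply, hAY, hmem, Set.mem_Iic, hsucc]
            by_cases h1 : (fun i => X i ω) ∈ A m <;>
              by_cases h2 : w m (fun i => X i ω) + X m ω ≤ x <;> simp [h1, h2]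
        _ = ∫⁻ y, ∫⁻ t, F (y, t) ∂ν ∂(P.map Y) := by
            rw [← lintegral_prod _ hFm.aemeasurable, ← hjoint,
              lintegral_map' hFm.aemeasurable (hYm.prodMk (hXm m))]
        _ ≤ ∫⁻ y, (A m).indicator (fun s => W (n + 1) (w m s)) (e y) ∂(P.map Y) := by
            refine lintegral_mono fun y => ?_
            simp only [hF, Set.indicator_apply (A m)]
            split_ifs with h
            · simpa using hstep n (w m (e y)) (h m le_rfl)
            · simp
        _ = _ := by
            have hm : Measurable
                fun y => (A m).indicator (fun s => W (n + 1) (w m s)) (e y) :=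
              (((hWm _).comp (hwm m)).indicator (hAm m)).comp hem
            rw [lintegral_map' hm.aemeasurable hYm]
            refine lintegral_congr fun ω => ?_
            simp only [Set.indicator_apply, hAY, hwY]
  refine le_trans ?_ (key N 0 (by simp))
  have hXm : AEMeasurable (fun ω i => X i ω) P :=
    aemeasurable_pi_lambda _ fun i => (hlaw i).aemeasurable
  calc P {ω | ∀ k ≤ N, walk X k ω ≤ x}
      = ∫⁻ ω, (A N).indicator 1 (fun i => X i ω) ∂P := by
        rw [← lintegral_map' (measurable_one.indicator (hAm N)).aemeasurable hXm,
          lintegral_indicator_one (hAm N), Measure.map_apply_of_aemeasurable hXm (hAm N)]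
        rfl
    _ ≤ _ := lintegral_mono fun ω => Set.indicator_le_indicator (hW0 _)

/-! ### The capped parabola and its mean decrease. -/

/-- The parabola `2 L w - w²` on `[0, L]`, continued by constants. -/
noncomputable def cappedParabola (L w : ℝ) : ℝ := L ^ 2 - max (L - max w 0) 0 ^ 2

theorem cappedParabola_nonneg {L : ℝ} (hL : 0 ≤ L) (w : ℝ) : 0 ≤ cappedParabola L w := by
  have h1 : max (L - max w 0) 0 ≤ L := max_le (by linarith [le_max_right w 0]) hL
  have h2 : 0 ≤ max (L - max w 0) 0 := le_max_right _ _
  unfold cappedParabola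
  nlinarith

theorem cappedParabola_le_sq (L w : ℝ) : cappedParabola L w ≤ L ^ 2 := by
  unfold cappedParabola
  nlinarith [sq_nonneg (max (L - max w 0) 0)]

theorem cappedParabola_of_mem {L w : ℝ} (h0 : 0 ≤ w) (h1 : w ≤ L) :
    cappedParabola L w = 2 * L * w - w ^ 2 := by
  unfold cappedParabola
  rw [max_eq_left h0, max_eq_left (by linarith)]
  ring

theorem cappedParabola_of_nonpos {L w : ℝ} (hL : 0 ≤ L) (h0 : w ≤ 0) :
    cappedParabola L w = 0 := by
  unfold cappedParabola
  rw [max_eq_right h0, max_eq_left (by linarith)]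
  ring

theorem cappedParabola_of_ge {L w : ℝ} (hL : 0 ≤ L) (h1 : L ≤ w) :
    cappedParabola L w = L ^ 2 := by
  unfold cappedParabola
  rw [max_eq_left (hL.trans h1), max_eq_right (by linarith)]
  ring

theorem cappedParabola_le_mul {L w : ℝ} (hL : 0 ≤ L) (hw : 0 ≤ w) :
    cappedParabola L w ≤ 2 * L * w := by
  rcases le_total w L with h | h
  · rw [cappedParabola_of_mem hw h]; nlinarith
  · rw [cappedParabola_of_ge hL h]; nlinarith

theorem sq_le_cappedParabola {L w : ℝ} (hL : 0 ≤ L) (hw : L / 2 ≤ w) :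
    L ^ 2 ≤ 2 * cappedParabola L w := by
  rcases le_total w L with h | h
  · rw [cappedParabola_of_mem (by linarith) h]; nlinarith
  · rw [cappedParabola_of_ge hL h]; nlinarith

@[fun_prop]
theorem continuous_cappedParabola (L : ℝ) : Continuous (cappedParabola L) := by
  unfold cappedParabola
  fun_prop

/-- The error made when the capped parabola is replaced by the parabola, at distance at least
`x` from `0` and at least `L / 2` from `L`. -/
noncomputable def parabolaError (a x L : ℝ) : ℝ :=
  (2 * L / a + 2 / a ^ 2) * Real.exp (-(a * x)) + 2 / a ^ 2 * Real.exp (-(a * (L / 2)))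

theorem le_exp_div {a u v : ℝ} (ha : 0 < a) (huv : u ≤ v) : u ≤ 1 / a * Real.exp (a * v) := by
  have h := Real.add_one_le_exp (a * v)
  rw [one_div, ← div_eq_inv_mul, le_div_iff₀ ha]
  nlinarith

theorem sq_le_exp_div {a u v : ℝ} (ha : 0 < a) (hu : 0 ≤ u) (huv : u ≤ v) :
    u ^ 2 ≤ 2 / a ^ 2 * Real.exp (a * v) := by
  have h := Real.quadratic_le_exp_of_nonneg (mul_nonneg ha.le (hu.trans huv))
  have h1 : 0 ≤ a * v := mul_nonneg ha.le (hu.trans huv)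
  rw [div_mul_eq_mul_div, le_div_iff₀ (by positivity)]
  have : (a * u) ^ 2 ≤ (a * v) ^ 2 := by gcongr
  nlinarith

/-- Between the caps the expansion is exact. Below `0` the error is linear plus quadratic in an
overshoot of at most `|t| - x`; above `L` it is the square of an overshoot of at most `|t| - L/2`.
Exponentials dominate both. -/
theorem cappedParabola_sub_le {a x L z t : ℝ} (ha : 0 < a) (hx : 0 ≤ x) (hxz : x ≤ z)
    (hzL : z ≤ L / 2) :
    cappedParabola L (z - t) ≤ cappedParabola L z - 2 * (L - z) * t - t ^ 2 +
      parabolaError a x L * Real.exp (a * |t|) := by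
  have hz : 0 ≤ z := hx.trans hxz
  have hL : 0 ≤ L := by linarith
  have e1 : Real.exp (-(a * x)) * Real.exp (a * |t|) = Real.exp (a * (|t| - x)) := by
    rw [← Real.exp_add]; ring_nf
  have e2 : Real.exp (-(a * (L / 2))) * Real.exp (a * |t|) = Real.exp (a * (|t| - L / 2)) := by
    rw [← Real.exp_add]; ring_nf
  have hB : parabolaError a x L * Real.exp (a * |t|) =
      2 * L * (1 / a * Real.exp (a * (|t| - x))) + 2 / a ^ 2 * Real.exp (a * (|t| - x)) +
        2 / a ^ 2 * Real.exp (a * (|t| - L / 2)) := by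
    rw [← e1, ← e2]; unfold parabolaError; ring
  have p1 : 0 ≤ 2 * L * (1 / a * Real.exp (a * (|t| - x))) := by positivity
  have p2 : 0 ≤ 2 / a ^ 2 * Real.exp (a * (|t| - x)) := by positivity
  have p3 : 0 ≤ 2 / a ^ 2 * Real.exp (a * (|t| - L / 2)) := by positivity
  rw [hB, cappedParabola_of_mem hz (by linarith)]
  rcases le_total (z - t) 0 with h | h
  · rw [cappedParabola_of_nonpos hL h]
    have hv : t - z ≤ |t| - x := by linarith [le_abs_self t]
    have q1 := mul_le_mul_of_nonneg_left (le_exp_div ha hv) (by linarith : 0 ≤ 2 * L)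
    have q2 := sq_le_exp_div ha (by linarith) hv
    nlinarith
  · rcases le_total (z - t) L with h' | h'
    · rw [cappedParabola_of_mem h h']
      nlinarith
    · rw [cappedParabola_of_ge hL h']
      have hv : z - t - L ≤ |t| - L / 2 := by linarith [neg_le_abs t]
      have q2 := sq_le_exp_div ha (by linarith) hv
      nlinarith

theorem integrable_id_and_sq_of_integrable_exp {ν : Measure ℝ} {a : ℝ} (ha : 0 < a)
    (hexp : Integrable (fun t => Real.exp (a * |t|)) ν) :
    Integrable (fun t => t) ν ∧ Integrable (fun t => t ^ 2) ν := by
  constructor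
  · refine (hexp.const_mul (1 / a)).mono' (by fun_prop) (.of_forall fun t => ?_)
    exact le_exp_div ha le_rfl
  · refine (hexp.const_mul (2 / a ^ 2)).mono' (by fun_prop) (.of_forall fun t => ?_)
    rw [Real.norm_eq_abs, abs_pow]
    exact sq_le_exp_div ha (abs_nonneg t) le_rfl

/-- The quadratic term gains `v`; drift and capping error may each use up a quarter of it. -/
theorem integral_cappedParabola_sub_le {ν : Measure ℝ} [IsProbabilityMeasure ν] {a x L z v : ℝ} (ha : 0 < a) (hx : 0 ≤ x) (hxz : x ≤ z)
    (hzL : z ≤ L / 2) (hexp : Integrable (fun t => Real.exp (a * |t|)) ν)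
    (hv : v ≤ ∫ t, t ^ 2 ∂ν) (hμ : 2 * L * |∫ t, t ∂ν| ≤ v / 4)
    (hB : parabolaError a x L * ∫ t, Real.exp (a * |t|) ∂ν ≤ v / 4) :
    ∫ t, cappedParabola L (z - t) ∂ν ≤ cappedParabola L z - v / 2 := by
  obtain ⟨h1, h2⟩ := integrable_id_and_sq_of_integrable_exp ha hexp
  have hz : 0 ≤ z := hx.trans hxz
  have hL : 0 ≤ L := by linarith
  have hQ : Integrable (fun t => cappedParabola L (z - t)) ν := by
    refine (integrable_const (L ^ 2)).mono' (by fun_prop) (.of_forall fun t => ?_)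
    rw [Real.norm_of_nonneg (cappedParabola_nonneg hL _)]
    exact cappedParabola_le_sq _ _
  have i1 : Integrable (fun t => cappedParabola L z - 2 * (L - z) * t) ν :=
    (integrable_const _).sub (h1.const_mul _)
  have i2 : Integrable (fun t => cappedParabola L z - 2 * (L - z) * t - t ^ 2) ν := i1.sub h2
  have i3 := hexp.const_mul (parabolaError a x L)
  have i4 : Integrable (fun t => cappedParabola L z - 2 * (L - z) * t - t ^ 2 +
      parabolaError a x L * Real.exp (a * |t|)) ν := i2.add i3
  have h := integral_mono hQ i4 fun t => cappedParabola_sub_le ha hx hxz hzL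
  have e : ∫ t, (cappedParabola L z - 2 * (L - z) * t - t ^ 2 +
      parabolaError a x L * Real.exp (a * |t|)) ∂ν =
      cappedParabola L z - 2 * (L - z) * ∫ t, t ∂ν - ∫ t, t ^ 2 ∂ν +
        parabolaError a x L * ∫ t, Real.exp (a * |t|) ∂ν := by
    rw [integral_add i2 i3, integral_sub i1 h2, integral_sub (integrable_const _)
      (h1.const_mul _), integral_const_mul, integral_const_mul]
    simp
  rw [e] at h
  have hdrift : -(2 * (L - z) * ∫ t, t ∂ν) ≤ 2 * L * |∫ t, t ∂ν| := by
    have := neg_abs_le (∫ t, t ∂ν)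
    have := abs_nonneg (∫ t, t ∂ν)
    nlinarith
  linarith

/-- A walk whose step law has an exponential moment stays below `x` for `N` steps with
probability at most `8 x / L`, for suitable length scales `L`. -/
theorem measureReal_walk_le_le {Ω : Type*} [MeasurableSpace Ω] {P : Measure Ω}
    [IsProbabilityMeasure P] {X : ℕ → Ω → ℝ} {ν : Measure ℝ} [IsProbabilityMeasure ν]
    (hind : iIndepFun X P) (hlaw : ∀ i, HasLaw (X i) ν P) {a x L v : ℝ} {N : ℕ} (hN : 0 < N)
    (ha : 0 < a) (hx : 0 ≤ x) (hL : 0 < L)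
    (hexp : Integrable (fun t => Real.exp (a * |t|)) ν)
    (hv : v ≤ ∫ t, t ^ 2 ∂ν) (hμ : 2 * L * |∫ t, t ∂ν| ≤ v / 4)
    (hB : parabolaError a x L * ∫ t, Real.exp (a * |t|) ∂ν ≤ v / 4)
    (hLN : L ^ 2 ≤ v * N) :
    P.real {ω | ∀ k ≤ N, walk X k ω ≤ x} ≤ 8 * x / L := by
  -- Centring at `2x` rather than `x` leaves a buffer of width `x` before the lower cap; the factor
  -- `2 / L ^ 2` makes `V ≥ 1` once the distance reaches `L / 2`.
  set V : ℝ → ℝ := fun y => 2 / L ^ 2 * cappedParabola L (2 * x - y) with hV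
  have hV0 : ∀ y, 0 ≤ V y := fun y => mul_nonneg (by positivity) (cappedParabola_nonneg hL.le _)
  have hVc : Continuous V := by simp only [hV]; fun_prop
  have hN' : (0 : ℝ) < N := by exact_mod_cast hN
  -- The value `1` for `n > N` makes the step inequality trivial there.
  set W : ℕ → ℝ → ENNReal := fun n y =>
    if n ≤ N then min 1 (ENNReal.ofReal (V y + (1 - n / N))) else 1 with hW
  have hWm : ∀ n, Measurable (W n) := fun n => by
    by_cases h : n ≤ N
    · simp only [hW, h, if_true]
      have := hVc.measurable
      fun_prop
    · simp only [hW, h, if_false]; fun_prop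
  have hle1 : ∀ n y, W n y ≤ 1 := fun n y => by
    simp only [hW]
    split_ifs
    · exact min_le_left _ _
    · exact le_rfl
  have hstep : ∀ n y, y ≤ x →
      ∫⁻ t, (Set.Iic x).indicator (W n) (y + t) ∂ν ≤ W (n + 1) y := by
    intro n y hy
    have htriv : ∫⁻ t, (Set.Iic x).indicator (W n) (y + t) ∂ν ≤ 1 := by
      calc _ ≤ ∫⁻ _, 1 ∂ν := lintegral_mono fun t =>
            (Set.indicator_le_self' (fun _ _ => zero_le) _).trans (hle1 _ _)
        _ = 1 := by simp
    by_cases hn : n + 1 ≤ N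
    · have hn' : ((n : ℝ) + 1) / N ≤ 1 := by
        rw [div_le_one hN']; exact_mod_cast hn
      have hn0 : (n : ℝ) / N + 1 / N = (n + 1) / N := by ring
      have hN1 : 0 < 1 / (N : ℝ) := by positivity
      simp only [hW, hn, if_true, Nat.cast_add, Nat.cast_one]
      refine le_min (by simpa only [hW] using htriv) ?_
      -- Far from the barrier `V ≥ 1`, so the truncation at `1` suffices; nearer, the mean decrease
      -- pays for the `1 / N` added to the linear term.
      rcases le_total (L / 2) (2 * x - y) with h | h
      · refine le_trans (by simpa only [hW] using htriv) ?_
        rw [ENNReal.one_le_ofReal]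
        have : 1 ≤ V y := by
          simp only [hV]
          rw [div_mul_eq_mul_div, one_le_div (by positivity)]
          exact sq_le_cappedParabola hL.le h
        linarith
      · have hq := integral_cappedParabola_sub_le ha hx (by linarith : x ≤ 2 * x - y) h hexp hv
          hμ hB
        have hVi : Integrable (fun t => V (y + t)) ν := by
          refine (integrable_const 2).mono' (by fun_prop) (.of_forall fun t => ?_)
          rw [Real.norm_of_nonneg (hV0 _)]
          simp only [hV]
          rw [div_mul_eq_mul_div, div_le_iff₀ (by positivity)]
          linarith [cappedParabola_le_sq L (2 * x - (y + t))]
        have hint : ∫ t, V (y + t) ∂ν ≤ V y - 1 / N := by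
          simp only [hV, integral_const_mul]
          have e : ∀ t, 2 * x - (y + t) = 2 * x - y - t := fun t => by ring
          simp only [e]
          calc _ ≤ 2 / L ^ 2 * (cappedParabola L (2 * x - y) - v / 2) := by gcongr
            _ = 2 / L ^ 2 * cappedParabola L (2 * x - y) - v / L ^ 2 := by ring
            _ ≤ _ := by
              gcongr 2 / L ^ 2 * cappedParabola L (2 * x - y) - ?_
              rw [div_le_div_iff₀ hN' (by positivity)]
              linarith
        calc _ ≤ ∫⁻ t, ENNReal.ofReal (V (y + t) + (1 - n / N)) ∂ν := by
              refine lintegral_mono fun t =>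
                (Set.indicator_le_self' (fun _ _ => zero_le) _).trans ?_
              simp only [show n ≤ N by omega, if_true]
              exact min_le_right _ _
          _ = ENNReal.ofReal (∫ t, (V (y + t) + (1 - n / N)) ∂ν) := by
              have hsum : Integrable (fun t => V (y + t) + (1 - (n : ℝ) / N)) ν :=
                hVi.add (integrable_const _)
              rw [ofReal_integral_eq_lintegral_ofReal hsum]
              exact .of_forall fun t => by
                have := hV0 (y + t)
                simp only [Pi.zero_apply]
                linarith
          _ ≤ _ := by
              refine ENNReal.ofReal_le_ofReal ?_
              rw [integral_add hVi (integrable_const _)]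
              simp only [integral_const, probReal_univ, one_smul]
              linarith
    · simpa only [hW, hn, if_false] using htriv
  have h := measure_walk_le_of_supersolution hind hlaw hWm (fun y => by
    have := hV0 y
    simp [hW, this]) hstep N
  have h0 : W N 0 ≤ ENNReal.ofReal (8 * x / L) := by
    simp only [hW, le_rfl, if_true, div_self hN'.ne', sub_self, add_zero]
    refine (min_le_right _ _).trans (ENNReal.ofReal_le_ofReal ?_)
    simp only [hV, sub_zero]
    have := cappedParabola_le_mul hL.le (by linarith : 0 ≤ 2 * x)
    calc 2 / L ^ 2 * cappedParabola L (2 * x) ≤ 2 / L ^ 2 * (2 * L * (2 * x)) := by gcongr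
      _ = 8 * x / L := by field_simp; ring
  exact ENNReal.toReal_le_of_le_ofReal (by positivity) (h.trans h0)

/-! ### Uniform moment bounds for log-gamma steps. -/

theorem lintegral_exp_mul_log_gammaMeasure {α s : ℝ} (hα : 0 < α) (hs : 0 < α + s) :
    ∫⁻ y, ENNReal.ofReal (Real.exp (s * Real.log y)) ∂(gammaMeasure α 1) =
      ENNReal.ofReal (Real.Gamma (α + s) / Real.Gamma α) := by
  have hm : ∀ b, Measurable (gammaPDF b 1) := fun b =>
    (measurable_gammaPDFReal b 1).ennreal_ofReal
  have hGα := Real.Gamma_pos_of_pos hα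
  have hGs := Real.Gamma_pos_of_pos hs
  rw [gammaMeasure, lintegral_withDensity_eq_lintegral_mul _ (hm α) (by fun_prop)]
  calc _ = ∫⁻ y, ENNReal.ofReal (Real.Gamma (α + s) / Real.Gamma α) * gammaPDF (α + s) 1 y := by
        have h0 : ∀ᵐ y : ℝ, y ≠ 0 := by simp [ae_iff]
        refine lintegral_congr_ae (h0.mono fun y hy => ?_)
        rcases lt_or_gt_of_ne hy with h | h
        · simp [gammaPDF_of_neg h]
        · simp only [Pi.mul_apply]
          rw [gammaPDF_of_nonneg h.le, gammaPDF_of_nonneg h.le, ← ENNReal.ofReal_mul (by positivity),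
            ← ENNReal.ofReal_mul (by positivity)]
          congr 1
          have e : y ^ (α + s - 1) = y ^ (α - 1) * Real.exp (s * Real.log y) := by
            rw [show α + s - 1 = (α - 1) + s by ring, Real.rpow_add h, Real.rpow_def_of_pos h s,
              mul_comm s]
          rw [e]
          simp only [Real.one_rpow]
          field_simp
    _ = _ := by
        rw [lintegral_const_mul _ (hm _), lintegral_gammaPDF_eq_one hs one_pos, mul_one]

/-- On `y ≥ 1`, `y ^ (α - 1) ≥ y⁻¹` for every `α > 0`, so the density bound depends on `α` only
through `G`. -/
theorem le_gammaMeasure_Icc {α c G : ℝ} (hα : 0 < α) (hc : 1 ≤ c) (hG : Real.Gamma α ≤ G) :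
    ENNReal.ofReal (1 / G * (c + 1)⁻¹ * Real.exp (-(c + 1))) ≤
      gammaMeasure α 1 (Set.Icc c (c + 1)) := by
  have hGα := Real.Gamma_pos_of_pos hα
  rw [gammaMeasure, withDensity_apply _ measurableSet_Icc]
  calc _ = ∫⁻ _ in Set.Icc c (c + 1),
        ENNReal.ofReal (1 / G * (c + 1)⁻¹ * Real.exp (-(c + 1))) := by simp
    _ ≤ _ := by
      refine setLIntegral_mono_ae (by unfold gammaPDF; fun_prop) (.of_forall fun y hy => ?_)
      have hy0 : 0 < y := by linarith [hy.1]
      rw [gammaPDF_of_nonneg hy0.le]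
      refine ENNReal.ofReal_le_ofReal ?_
      have h1 : (c + 1)⁻¹ ≤ y ^ (α - 1) := by
        calc (c + 1)⁻¹ ≤ y⁻¹ := inv_anti₀ hy0 hy.2
          _ = y ^ (-1 : ℝ) := (Real.rpow_neg_one y).symm
          _ ≤ _ := Real.rpow_le_rpow_of_exponent_le (by linarith [hy.1]) (by linarith)
      rw [Real.one_rpow, one_mul]
      have : 0 ≤ (c + 1)⁻¹ := by positivity
      gcongr
      exact hy.2

theorem measurable_log_sub_log :
    Measurable (fun g : ℝ × ℝ => Real.log g.1 - Real.log g.2) := by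
  fun_prop

theorem isProbabilityMeasure_logGammaStepLaw {α β : ℝ} (hα : 0 < α) (hβ : 0 < β) :
    IsProbabilityMeasure (logGammaStepLaw α β) := by
  have := isProbabilityMeasure_gammaMeasure hα one_pos
  have := isProbabilityMeasure_gammaMeasure hβ one_pos
  exact Measure.isProbabilityMeasure_map measurable_log_sub_log.aemeasurable

theorem lintegral_exp_abs_logGammaStepLaw_le {α β a : ℝ} (ha : 0 < a) (hα : a < α) (hβ : a < β) :
    ∫⁻ t, ENNReal.ofReal (Real.exp (a * |t|)) ∂(logGammaStepLaw α β) ≤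
      ENNReal.ofReal (Real.Gamma (α + a) / Real.Gamma α) *
        ENNReal.ofReal (Real.Gamma (β - a) / Real.Gamma β) +
      ENNReal.ofReal (Real.Gamma (α - a) / Real.Gamma α) *
        ENNReal.ofReal (Real.Gamma (β + a) / Real.Gamma β) := by
  have hα0 := ha.trans hα
  have hβ0 := ha.trans hβ
  have := isProbabilityMeasure_gammaMeasure hα0 one_pos
  have := isProbabilityMeasure_gammaMeasure hβ0 one_pos
  rw [logGammaStepLaw, lintegral_map (by fun_prop) measurable_log_sub_log]
  set f : ℝ → ℝ → ENNReal := fun s y => ENNReal.ofReal (Real.exp (s * Real.log y)) with hf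
  have hfm : ∀ s, Measurable (f s) := fun s => by simp only [hf]; fun_prop
  calc _ ≤ ∫⁻ g : ℝ × ℝ, (f a g.1 * f (-a) g.2 + f (-a) g.1 * f a g.2)
        ∂((gammaMeasure α 1).prod (gammaMeasure β 1)) := by
        refine lintegral_mono fun g => ?_
        simp only [hf]
        rw [← ENNReal.ofReal_mul (by positivity), ← ENNReal.ofReal_mul (by positivity),
          ← ENNReal.ofReal_add (by positivity) (by positivity), ← Real.exp_add, ← Real.exp_add]
        refine ENNReal.ofReal_le_ofReal ?_
        rcases abs_cases (Real.log g.1 - Real.log g.2) with ⟨h, -⟩ | ⟨h, -⟩ <;> rw [h]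
        · rw [show a * (Real.log g.1 - Real.log g.2) = a * Real.log g.1 + -a * Real.log g.2 by ring]
          exact le_add_of_nonneg_right (by positivity)
        · rw [show a * -(Real.log g.1 - Real.log g.2) = -a * Real.log g.1 + a * Real.log g.2 by
            ring]
          exact le_add_of_nonneg_left (by positivity)
    _ = _ := by
        have m1 := hfm a
        have m2 := hfm (-a)
        rw [lintegral_add_left (by fun_prop), lintegral_prod_mul m1.aemeasurable m2.aemeasurable,
          lintegral_prod_mul m2.aemeasurable m1.aemeasurable]
        simp only [hf]
        rw [lintegral_exp_mul_log_gammaMeasure hα0 (by linarith),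
          lintegral_exp_mul_log_gammaMeasure hβ0 (by linarith),
          lintegral_exp_mul_log_gammaMeasure hα0 (by linarith),
          lintegral_exp_mul_log_gammaMeasure hβ0 (by linarith)]
        simp only [← sub_eq_add_neg]

/-- Nondegeneracy: if the first gamma variable lies in `[1, 2]` and the second in `[3, 4]`, their
logarithms differ by at least `log (3 / 2)`. -/
theorem le_logGammaStepLaw_sq {α β G : ℝ} (hα : 0 < α) (hβ : 0 < β)
    (hαG : Real.Gamma α ≤ G) (hβG : Real.Gamma β ≤ G) :
    ENNReal.ofReal (1 / G * (1 + 1)⁻¹ * Real.exp (-(1 + 1))) *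
        ENNReal.ofReal (1 / G * (3 + 1)⁻¹ * Real.exp (-(3 + 1))) ≤
      logGammaStepLaw α β {t | Real.log (3 / 2) ^ 2 ≤ t ^ 2} := by
  have := isProbabilityMeasure_gammaMeasure hα one_pos
  have := isProbabilityMeasure_gammaMeasure hβ one_pos
  rw [logGammaStepLaw, Measure.map_apply measurable_log_sub_log
    (measurableSet_le measurable_const (by fun_prop))]
  calc _ ≤ gammaMeasure α 1 (Set.Icc 1 (1 + 1)) * gammaMeasure β 1 (Set.Icc 3 (3 + 1)) :=
        mul_le_mul' (le_gammaMeasure_Icc hα le_rfl hαG)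
          (le_gammaMeasure_Icc hβ (by norm_num) hβG)
    _ = (gammaMeasure α 1).prod (gammaMeasure β 1)
          (Set.Icc 1 (1 + 1) ×ˢ Set.Icc 3 (3 + 1)) := (Measure.prod_prod _ _).symm
    _ ≤ _ := by
        refine measure_mono ?_
        rintro ⟨y, z⟩ ⟨⟨hy1, hy2⟩, hz1, -⟩
        simp only at hy1 hy2 hz1
        have h1 : Real.log y ≤ Real.log 2 := Real.log_le_log (by linarith) (by linarith)
        have h2 : Real.log 3 ≤ Real.log z := Real.log_le_log (by norm_num) hz1
        have h3 : Real.log (3 / 2) = Real.log 3 - Real.log 2 :=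
          Real.log_div (by norm_num) (by norm_num)
        have h4 : 0 ≤ Real.log (3 / 2) := Real.log_nonneg (by norm_num)
        simp only [Set.preimage_ofPred_eq, Set.mem_ofPred_eq]
        nlinarith

theorem exists_Gamma_bounds {p q : ℝ} (hp : 0 < p) :
    ∃ m G : ℝ, 0 < m ∧ 0 < G ∧ ∀ y ∈ Set.Icc p q, m ≤ Real.Gamma y ∧ Real.Gamma y ≤ G := by
  have hc : ContinuousOn Real.Gamma (Set.Icc p q) := fun y hy =>
    (Real.differentiableAt_Gamma fun k => by
      have := hp.trans_le hy.1
      have : (0 : ℝ) ≤ k := k.cast_nonneg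
      linarith).continuousAt.continuousWithinAt
  obtain ⟨m, hm, hm'⟩ := isCompact_Icc.exists_forall_le' hc
    (fun y hy => Real.Gamma_pos_of_pos (hp.trans_le hy.1))
  obtain ⟨G, hG⟩ := isCompact_Icc.bddAbove_image hc
  exact ⟨m, max G 1, hm, by positivity, fun y hy =>
    ⟨hm' y hy, (hG ⟨y, hy, rfl⟩).trans (le_max_left _ _)⟩⟩

theorem exists_logGammaStepLaw_moment_bounds {p q : ℝ} (hp : 0 < p) :
    ∃ a M v : ℝ, 0 < a ∧ 0 < M ∧ 0 < v ∧ ∀ α ∈ Set.Icc p q, ∀ β ∈ Set.Icc p q,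
      Integrable (fun t => Real.exp (a * |t|)) (logGammaStepLaw α β) ∧
      ∫ t, Real.exp (a * |t|) ∂(logGammaStepLaw α β) ≤ M ∧
      v ≤ ∫ t, t ^ 2 ∂(logGammaStepLaw α β) := by
  obtain ⟨m, G, hm, hG, hmG⟩ := exists_Gamma_bounds (p := p / 2) (q := q + p / 2) (half_pos hp)
  have hr : 0 ≤ G / m := by positivity
  set r₁ := 1 / G * (1 + 1)⁻¹ * Real.exp (-(1 + 1)) with hr₁
  set r₂ := 1 / G * (3 + 1)⁻¹ * Real.exp (-(3 + 1)) with hr₂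
  have h1 : 0 < r₁ := by positivity
  have h2 : 0 < r₂ := by positivity
  have hlog : 0 < Real.log (3 / 2) := Real.log_pos (by norm_num)
  -- The exponent `p / 2` keeps every Gamma argument in `[p / 2, q + p / 2]`.
  refine ⟨p / 2, G / m * (G / m) + G / m * (G / m), Real.log (3 / 2) ^ 2 * (r₁ * r₂),
    half_pos hp, by positivity, by positivity, fun α hα β hβ => ?_⟩
  have hα0 : 0 < α := hp.trans_le hα.1
  have hβ0 : 0 < β := hp.trans_le hβ.1
  have := isProbabilityMeasure_logGammaStepLaw hα0 hβ0
  have hratio : ∀ y z, y ∈ Set.Icc (p / 2) (q + p / 2) → z ∈ Set.Icc (p / 2) (q + p / 2) →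
      ENNReal.ofReal (Real.Gamma y / Real.Gamma z) ≤ ENNReal.ofReal (G / m) := fun y z hy hz =>
    ENNReal.ofReal_le_ofReal (div_le_div₀ hG.le (hmG y hy).2 hm (hmG z hz).1)
  obtain ⟨hα1, hα2⟩ := hα
  obtain ⟨hβ1, hβ2⟩ := hβ
  have hlin : ∫⁻ t, ENNReal.ofReal (Real.exp (p / 2 * |t|)) ∂(logGammaStepLaw α β) ≤
      ENNReal.ofReal (G / m * (G / m) + G / m * (G / m)) := by
    refine (lintegral_exp_abs_logGammaStepLaw_le (half_pos hp) (by linarith)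
      (by linarith)).trans ?_
    rw [ENNReal.ofReal_add (by positivity) (by positivity), ENNReal.ofReal_mul hr]
    refine add_le_add (mul_le_mul' ?_ ?_) (mul_le_mul' ?_ ?_) <;>
      refine hratio _ _ ⟨?_, ?_⟩ ⟨?_, ?_⟩ <;> linarith
  have hint : Integrable (fun t => Real.exp (p / 2 * |t|)) (logGammaStepLaw α β) := by
    refine ⟨by fun_prop, ?_⟩
    rw [hasFiniteIntegral_iff_ofReal (.of_forall fun t => (Real.exp_pos _).le)]
    exact hlin.trans_lt ENNReal.ofReal_lt_top
  refine ⟨hint, ?_, ?_⟩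
  · rw [integral_eq_lintegral_of_nonneg_ae (.of_forall fun t => (Real.exp_pos _).le)
      (by fun_prop)]
    exact ENNReal.toReal_le_of_le_ofReal (by positivity) hlin
  · have hmarkov := mul_meas_ge_le_integral_of_nonneg (μ := logGammaStepLaw α β)
      (f := fun t => t ^ 2) (.of_forall fun t => sq_nonneg t)
      (integrable_id_and_sq_of_integrable_exp (half_pos hp) hint).2 (Real.log (3 / 2) ^ 2)
    refine le_trans ?_ hmarkov
    gcongr
    have h := le_logGammaStepLaw_sq hα0 hβ0 (hmG α ⟨by linarith, by linarith⟩).2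
      (hmG β ⟨by linarith, by linarith⟩).2
    rw [← ENNReal.ofReal_mul h1.le] at h
    exact (ENNReal.ofReal_le_iff_le_toReal (measure_ne_top _ _)).1 h

/-! ### Choice of the length scale and conclusion. -/

/-- Here `u` stands for `log N`. Once `a * u ≥ 1`, `exp (-(a * x)) ≤ exp (-u)` beats `L ≤ exp (u /
2)`; the upper-cap term is small for large `L` alone, so `L₀` does not depend on `u`. -/
theorem eventually_parabolaError_le {a M ε : ℝ} (ha : 0 < a) (hε : 0 < ε) :
    ∃ L₀ : ℝ, 0 < L₀ ∧ ∀ᶠ u : ℝ in Filter.atTop, ∀ x L : ℝ, u ^ 2 ≤ x → L₀ ≤ L →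
      L ≤ Real.exp (u / 2) → parabolaError a x L * M ≤ ε := by
  have hlim : ∀ b : ℝ, 0 < b →
      Filter.Tendsto (fun u => Real.exp (-(b * u))) Filter.atTop (nhds 0) := fun b hb =>
    Real.tendsto_exp_neg_atTop_nhds_zero.comp (Filter.tendsto_id.const_mul_atTop hb)
  have t1 : Filter.Tendsto (fun L => 2 / a ^ 2 * Real.exp (-(a / 2 * L)) * |M|)
      Filter.atTop (nhds 0) := by
    simpa using ((hlim (a / 2) (half_pos ha)).const_mul (2 / a ^ 2)).mul_const |M|
  have t2 : Filter.Tendsto (fun u => (2 / a * Real.exp (-(1 / 2 * u)) +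
      2 / a ^ 2 * Real.exp (-(1 * u))) * |M|) Filter.atTop (nhds 0) := by
    simpa using (((hlim (1 / 2) (by norm_num)).const_mul (2 / a)).add
      ((hlim 1 one_pos).const_mul (2 / a ^ 2))).mul_const |M|
  obtain ⟨L₁, hL₁⟩ := Filter.eventually_atTop.1 (t1.eventually_le_const (half_pos hε))
  refine ⟨max L₁ 1, by positivity, ?_⟩
  filter_upwards [t2.eventually_le_const (half_pos hε), Filter.eventually_ge_atTop (1 / a),
    Filter.eventually_ge_atTop 0] with u hu hua hu0 x L hx hL hLu
  have h1 := hL₁ L ((le_max_left _ _).trans hL)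
  have hL0 : 0 ≤ L := by linarith [le_max_right L₁ 1]
  have hau : 1 ≤ a * u := by rwa [div_le_iff₀' ha] at hua
  have hexp : Real.exp (-(a * x)) ≤ Real.exp (-(1 * u)) := by
    refine Real.exp_le_exp.2 ?_
    nlinarith
  have hE : Real.exp (u / 2) * Real.exp (-(1 * u)) = Real.exp (-(1 / 2 * u)) := by
    rw [← Real.exp_add]; ring_nf
  have hL' : -(a / 2 * L) = -(a * (L / 2)) := by ring
  rw [hL'] at h1
  calc parabolaError a x L * M ≤ parabolaError a x L * |M| := by
        have : 0 ≤ parabolaError a x L := by unfold parabolaError; positivity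
        gcongr
        exact le_abs_self M
    _ ≤ ((2 * Real.exp (u / 2) / a + 2 / a ^ 2) * Real.exp (-(1 * u)) +
          2 / a ^ 2 * Real.exp (-(a * (L / 2)))) * |M| := by
        unfold parabolaError
        gcongr
    _ = (2 / a * (Real.exp (u / 2) * Real.exp (-(1 * u))) + 2 / a ^ 2 * Real.exp (-(1 * u))) * |M|
          + 2 / a ^ 2 * Real.exp (-(a * (L / 2))) * |M| := by ring
    _ ≤ ε := by rw [hE]; linarith

theorem mainTheorem3 (ρmin ρmax a₀ : ℝ) (hρmin : 0 < ρmin) (hρ : ρmin ≤ ρmax) (ha₀ : 0 < a₀) :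
    ∃ (C : ℝ) (N₀ : ℕ), 0 < C ∧ 1 ≤ N₀ ∧
      ∀ s : ℕ → ℝ, (∀ N : ℕ, 2 ≤ N → 0 ≤ s N ∧ s N ≤ a₀ * (Real.log N ^ 3)⁻¹) →
      ∀ N : ℕ, N₀ ≤ N →
      ∀ α β : ℝ, (α, β) ∈ admissiblePairs ρmin ρmax (s N) →
      ∀ x : ℝ, Real.log N ^ 2 ≤ x →
      ∀ {Ω : Type*} [MeasurableSpace Ω] (P : Measure Ω) [IsProbabilityMeasure P]
        (X : ℕ → Ω → ℝ), IsLogGammaSteps P α β X →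
        P.real {ω | runningMax X N ω ≤ x} ≤
          C * x * Real.log N * max |logGammaMean α β| ((N : ℝ) ^ (-(1 / 2) : ℝ)) := by
  obtain ⟨a, M, v, ha, hM, hv, hmom⟩ :=
    exists_logGammaStepLaw_moment_bounds (p := ρmin) (q := ρmax) hρmin
  obtain ⟨L₀, hL₀, hev⟩ := eventually_parabolaError_le (M := M) ha (ε := v / 4) (by positivity)
  -- `v / 8` absorbs the drift, since `L * |μ| ≤ c`; `1` gives `L ≤ √N`; together they give `c ^ 2 ≤
  -- v`, hence `L ^ 2 ≤ v * N`.
  set c := min (v / 8) 1 with hc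
  have hc0 : 0 < c := by positivity
  have hc1 : c ≤ 1 := min_le_right _ _
  have hcv : c ≤ v / 8 := min_le_left _ _
  have hlogN : Filter.Tendsto (fun N : ℕ => Real.log N) Filter.atTop Filter.atTop :=
    Real.tendsto_log_atTop.comp tendsto_natCast_atTop_atTop
  obtain ⟨N₁, hN₁⟩ := Filter.eventually_atTop.1
    ((hlogN.eventually hev).and (hlogN.eventually_ge_atTop 1))
  refine ⟨max 8 L₀ / c, max N₁ 1, by positivity, le_max_right _ _, ?_⟩
  intro s _ N hN α β hαβ x hx Ω _ P _ X hX
  obtain ⟨hα, hβ, -, -⟩ := hαβ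
  have := isProbabilityMeasure_logGammaStepLaw (hρmin.trans_le hα.1) (hρmin.trans_le hβ.1)
  obtain ⟨hexp, hexpM, hvar⟩ := hmom α hα β hβ
  obtain ⟨hN₂, hlog⟩ := hN₁ N ((le_max_left _ _).trans hN)
  have hN1 : 1 ≤ N := (le_max_right _ _).trans hN
  have hN0 : (0 : ℝ) < N := by exact_mod_cast hN1
  have hx1 : 1 ≤ x := by nlinarith
  set δ := max |logGammaMean α β| ((N : ℝ) ^ (-(1 / 2) : ℝ)) with hδ
  have hNδ : (N : ℝ) ^ (-(1 / 2) : ℝ) ≤ δ := le_max_right _ _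
  have hδ0 : 0 < δ := (Real.rpow_pos_of_pos hN0 _).trans_le hNδ
  have hsqrt : (N : ℝ) ^ (-(1 / 2) : ℝ) = (Real.exp (Real.log N / 2))⁻¹ := by
    rw [Real.rpow_def_of_pos hN0, ← Real.exp_neg]; ring_nf
  have hsq : Real.exp (Real.log N / 2) ^ 2 = N := by
    rw [← Real.exp_nat_mul]; push_cast; rw [mul_div_cancel₀ _ two_ne_zero, Real.exp_log hN0]
  set L := c / δ with hL
  have hL0 : 0 < L := by positivity
  have hLδ : L * δ = c := div_mul_cancel₀ _ hδ0.ne'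
  have hLN : L ≤ c * Real.exp (Real.log N / 2) := by
    rw [hL, div_le_iff₀ hδ0]
    rw [hsqrt, inv_le_iff_one_le_mul₀' (Real.exp_pos _)] at hNδ
    nlinarith
  have hsub : {ω | runningMax X N ω ≤ x} ⊆ {ω | ∀ k ≤ N, walk X k ω ≤ x} := by
    intro ω hω k hk
    rcases Nat.eq_zero_or_pos k with rfl | h0
    · simp only [walk, Finset.range_zero, Finset.sum_empty]; linarith
    · exact (runningMax_le_iff X hN1 ω x).1 hω k (Finset.mem_Icc.2 ⟨h0, hk⟩)
  have hrhs : max 8 L₀ * x / L ≤ max 8 L₀ / c * x * Real.log N * δ := by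
    have : max 8 L₀ * x / L = max 8 L₀ / c * x * 1 * δ := by
      rw [hL]; field_simp
    rw [this]
    gcongr
  rcases le_total L₀ L with hLL | hLL
  · have hexpL : L ≤ Real.exp (Real.log N / 2) :=
      hLN.trans (mul_le_of_le_one_left (Real.exp_pos _).le hc1)
    have hB : parabolaError a x L * ∫ t, Real.exp (a * |t|) ∂(logGammaStepLaw α β) ≤ v / 4 := by
      refine le_trans ?_ (hN₂ x L hx hLL hexpL)
      have : 0 ≤ parabolaError a x L := by unfold parabolaError; positivity
      gcongr
    have hμ : 2 * L * |∫ t, t ∂(logGammaStepLaw α β)| ≤ v / 4 := by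
      have : |logGammaMean α β| ≤ δ := le_max_left _ _
      have h2 : L * |logGammaMean α β| ≤ L * δ := by gcongr
      rw [logGammaMean] at h2
      linarith
    have hLN2 : L ^ 2 ≤ v * N := by
      calc L ^ 2 ≤ (c * Real.exp (Real.log N / 2)) ^ 2 := by gcongr
        _ = c ^ 2 * N := by rw [mul_pow, hsq]
        _ ≤ v * N := by gcongr; nlinarith
    calc _ ≤ P.real {ω | ∀ k ≤ N, walk X k ω ≤ x} := measureReal_mono hsub
      _ ≤ 8 * x / L := measureReal_walk_le_le hX.indep hX.law hN1 ha (by linarith) hL0 hexp hvar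
          hμ hB hLN2
      _ ≤ max 8 L₀ * x / L := by gcongr; exact le_max_left _ _
      _ ≤ _ := hrhs
  -- For `L ≤ L₀` the claimed bound is at least `1`; this is why `L₀` enters the constant.
  · refine le_trans (measureReal_le_one) (le_trans ?_ hrhs)
    rw [one_le_div hL0]
    have : L₀ ≤ max 8 L₀ := le_max_right _ _
    nlinarith
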